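/- Call a pair $(X,T)$ a flow if $X$ is a compact metric space and $T:\mathbb{R}\times X\to X$, $(t,x)\mapsto T_t x$, is a continuous action of the additive group $\mathbb{R}$; let $\mathrm{Fix}(X,T)=\{x\in X : T_t x=x \text{ for all } t\in\mathbb{R}\}$, with the subspace topology. Let $L(\mathbb{R})$ be the set of maps $\varphi:\mathbb{R}\to[0,1]$ satisfying $|\varphi(s)-\varphi(t)|\le|s-t|$ for all $s,t\in\mathbb{R}$, endowed with the topology of uniform convergence on compact subsets of $\mathbb{R}$ (for which it is compact and metrizable) and with the continuous translation action of $\mathbb{R}$ in which $s\in\mathbb{R}$ sends $\varphi$ to $t\mapsto\varphi(t+s)$. **Theorem 1.2.** For every flow $(X,T)$, there is an $\mathbb{R}$-equivariant topological embedding $f:X\to L(\mathbb{R})$ if and only if there is a topological embedding of $\mathrm{Fix}(X,T)$ into the unit interval $[0,1]$. -/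

import Mathlib

open Topology

/-- The set `L(ℝ)` of maps `φ : ℝ → [0,1]` with `|φ s - φ t| ≤ |s - t|` for all `s`, `t`,
as a subset of the space `C(ℝ, [0,1])` of continuous maps. The latter carries the compact-open
topology, that is, the topology of uniform convergence on compact subsets of `ℝ`. -/
def lipschitzSet : Set C(ℝ, unitInterval) :=
  {φ | ∀ s t : ℝ, |(φ s : ℝ) - (φ t : ℝ)| ≤ |s - t|}

/-- The space `L(ℝ)`, with the topology induced from `C(ℝ, [0,1])`. -/
abbrev LipSpace : Type := lipschitzSet

/-- The translation flow on `C(ℝ, [0,1])`: time `s` sends `φ` to `t ↦ φ (t + s)`. -/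
def translationFlow : Flow ℝ C(ℝ, unitInterval) where
  toFun s φ := ⟨fun t => φ (t + s), by fun_prop⟩
  cont' := by
    refine ContinuousMap.continuous_of_continuous_uncurry _ ?_
    change Continuous fun p : (ℝ × C(ℝ, unitInterval)) × ℝ => p.1.2 (p.2 + p.1.1)
    fun_prop
  map_add' s₁ s₂ φ := by
    ext t
    simp [add_assoc]
  map_zero' φ := by
    ext t
    simp

theorem translationFlow_apply (s : ℝ) (φ : C(ℝ, unitInterval)) (t : ℝ) :
    translationFlow s φ t = φ (t + s) := rfl

theorem isInvariant_lipschitzSet : IsInvariant translationFlow lipschitzSet := by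
  intro s φ hφ a b
  have h := hφ (a + s) (b + s)
  rwa [add_sub_add_right_eq_sub] at h

/-- The translation flow on `L(ℝ)`. -/
def LipSpace.flow : Flow ℝ LipSpace :=
  translationFlow.restrict isInvariant_lipschitzSet

/-- The space `L(ℝ)` is compact. -/
instance LipSpace.instCompactSpace : CompactSpace LipSpace := by
  rw [← isCompact_iff_compactSpace]
  refine ArzelaAscoli.isCompact_of_equicontinuous _ ?_ ?_
  · have himg : ContinuousMap.toFun '' lipschitzSet =
        {f : ℝ → unitInterval | ∀ s t : ℝ, |(f s : ℝ) - (f t : ℝ)| ≤ |s - t|} := by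
      ext f
      constructor
      · rintro ⟨φ, hφ, rfl⟩
        exact hφ
      · intro hf
        have hlip : LipschitzWith 1 f := LipschitzWith.of_dist_le_mul fun s t => by
          simpa [Subtype.dist_eq, Real.dist_eq] using hf s t
        exact ⟨⟨f, hlip.continuous⟩, hf, rfl⟩
    rw [himg]
    refine IsClosed.isCompact ?_
    simp only [Set.ofPred_forall]
    refine isClosed_iInter fun s => isClosed_iInter fun t => isClosed_le ?_ continuous_const
    fun_prop
  · refine (LipschitzWith.uniformEquicontinuous _ 1 fun φ => ?_).equicontinuous
    exact LipschitzWith.of_dist_le_mul fun s t => by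
      simpa [Subtype.dist_eq, Real.dist_eq] using φ.2 s t

/-- The set `Fix(X, T)` of points fixed by all times of a flow. -/
def Flow.fixSet {X : Type*} [TopologicalSpace X] (T : Flow ℝ X) : Set X :=
  {x | ∀ t : ℝ, T t x = x}

/-- `f` is an embedding of the flow `(X, T)` in the flow `(Y, S)`: an `ℝ`-equivariant topological
embedding. -/
structure Flow.IsEquivariantEmbedding {X Y : Type*} [TopologicalSpace X] [TopologicalSpace Y]
    (T : Flow ℝ X) (S : Flow ℝ Y) (f : X → Y) : Prop where
  isEmbedding : IsEmbedding f
  equivariant : ∀ (t : ℝ) (x : X), f (T t x) = S t (f x)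

/-! An equivariant continuous map into `L(ℝ)` is `x ↦ (t ↦ f (T t x))` with `f : X → [0,1]`
continuous and 1-Lipschitz along orbits; by compactness it is an embedding as soon as it is
injective. Fixed points become constants, whence necessity. For sufficiency, place the fixed points
in `[1/4, 3/4]` and apply Baire category to the complete space of such `f` with this prescribed
restriction (`exists_separating_lipExtension`). The heart is density (`exists_perturbation`): give
`f` slope slack `ε`, subtract a small fast oscillation near a non-fixed `p`, and restore slope 1 by
infimal convolution. If an orbit piece near `p` then matched an unperturbed one, its slope would
stay below 1, so the convolution would change nothing there and the oscillation would be too steep.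
-/

open Set Filter

namespace Flow

/-! ### Infimal convolution along orbits -/

section InfConvolution

variable {X : Type*} [TopologicalSpace X] (T : Flow ℝ X)

/-- The infimal convolution along the orbits of a flow with `t ↦ c * |t|`. -/
theorem exists_infConvolution {F : X → ℝ} (hF : Continuous F) (hF0 : ∀ x, 0 ≤ F x)
    (hF1 : ∀ x, F x ≤ 1) {c : ℝ} (hc : 0 < c) :
    ∃ g : C(X, ℝ), (∀ x t, g x ≤ F (T t x) + c * |t|) ∧
      ∀ x, ∃ t, g x = F (T t x) + c * |t| := by
  -- Beyond `c⁻¹` the penalty exceeds `1 ≥ F`, so time 0 does better.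
  have hK : IsCompact (Icc (-c⁻¹) c⁻¹) := isCompact_Icc
  have hi : 0 < c⁻¹ := inv_pos.mpr hc
  have hne : (0 : ℝ) ∈ Icc (-c⁻¹) c⁻¹ := ⟨by linarith, by linarith⟩
  have hjoint : Continuous fun z : X × ℝ => F (T z.2 z.1) + c * |z.2| :=
    (hF.comp (T.continuous continuous_snd continuous_fst)).add (by fun_prop)
  have hmin : ∀ x, ∃ t, sInf ((fun t => F (T t x) + c * |t|) '' Icc (-c⁻¹) c⁻¹) =
      F (T t x) + c * |t| ∧ ∀ s, F (T t x) + c * |t| ≤ F (T s x) + c * |s| := by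
    intro x
    obtain ⟨t, ht, heq, hle⟩ := hK.exists_sInf_image_eq_and_le ⟨0, hne⟩
      (f := fun t => F (T t x) + c * |t|)
      (hjoint.comp (Continuous.prodMk_right x)).continuousOn
    refine ⟨t, heq, fun s => ?_⟩
    by_cases hs : s ∈ Icc (-c⁻¹) c⁻¹
    · exact hle s hs
    · refine (hle 0 hne).trans ?_
      have h1 : c⁻¹ < |s| := by
        by_contra! h
        exact hs (abs_le.mp h)
      have h2 : 1 ≤ c * |s| := by
        rw [← mul_inv_cancel₀ hc.ne']
        exact mul_le_mul_of_nonneg_left h1.le hc.le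
      have := hF1 (T 0 x)
      have := hF0 (T s x)
      simp only [abs_zero, mul_zero, add_zero]
      linarith
  refine ⟨⟨fun x => sInf ((fun t => F (T t x) + c * |t|) '' Icc (-c⁻¹) c⁻¹),
    hK.continuous_sInf (f := fun x t => F (T t x) + c * |t|) hjoint⟩, fun x t => ?_, fun x => ?_⟩
  · obtain ⟨s, hs, hle⟩ := hmin x
    exact hs.trans_le (hle t)
  · obtain ⟨s, hs, -⟩ := hmin x
    exact ⟨s, hs⟩

variable {T}

/-- Moving the base point by `s` turns the competitor `t` into `t - s`, at extra cost at most `c *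
|s|`. -/
theorem lipschitz_of_infConvolution {F g : X → ℝ} {c : ℝ} (hc : 0 ≤ c)
    (hle : ∀ x t, g x ≤ F (T t x) + c * |t|) (hex : ∀ x, ∃ t, g x = F (T t x) + c * |t|)
    (s : ℝ) (x : X) : |g (T s x) - g x| ≤ c * |s| := by
  have key : ∀ (s : ℝ) (x : X), g (T s x) ≤ g x + c * |s| := by
    intro s x
    obtain ⟨t, ht⟩ := hex x
    have h1 := hle (T s x) (t - s)
    rw [← T.map_add, sub_add_cancel] at h1
    have h2 := mul_le_mul_of_nonneg_left (abs_sub t s) hc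
    linarith
  have h1 := key s x
  have h2 := key (-s) (T s x)
  rw [← T.map_add, neg_add_cancel, T.map_zero_apply, abs_neg] at h2
  rw [abs_le]
  constructor <;> linarith

theorem infConvolution_eq_of_mem_fixSet {F g : X → ℝ} {c : ℝ} (hc : 0 ≤ c)
    (hle : ∀ x t, g x ≤ F (T t x) + c * |t|) (hex : ∀ x, ∃ t, g x = F (T t x) + c * |t|)
    {x : X} (hx : x ∈ T.fixSet) : g x = F x := by
  obtain ⟨t, ht⟩ := hex x
  have h1 := hle x 0
  rw [hx] at ht h1
  have : 0 ≤ c * |t| := by positivity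
  rw [abs_zero, mul_zero, add_zero] at h1
  linarith

end InfConvolution

/-! ### Oscillation and non-fixed points -/

/-- A Lipschitz bound for the oscillating function `cos (π κ)` limits the range of `κ`. -/
theorem natCast_le_of_lipschitz_cos {L : ℝ} (n : ℕ) :
    ∀ (κ : ℝ → ℝ), Continuous κ → ∀ a b : ℝ, a ≤ b → κ a = 0 → κ b = n →
      (∀ s ∈ Icc a b, ∀ t ∈ Icc a b,
        |Real.cos (Real.pi * κ s) - Real.cos (Real.pi * κ t)| ≤ L * |s - t|) →
      2 * (n : ℝ) ≤ L * (b - a) := by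
  induction n with
  | zero =>
    intro κ hκ a b hab ha hb h
    have h1 := h b ⟨hab, le_rfl⟩ a ⟨le_rfl, hab⟩
    rw [abs_of_nonneg (sub_nonneg.mpr hab)] at h1
    simpa using (abs_nonneg _).trans h1
  | succ n ih =>
    intro κ hκ a b hab ha hb h
    -- From level `n` to level `n + 1` the cosine changes by 2.
    obtain ⟨c, hc, hcn⟩ := intermediate_value_Icc hab hκ.continuousOn
      (show (n : ℝ) ∈ Icc (κ a) (κ b) by
        rw [ha, hb]
        exact ⟨by positivity, by push_cast; linarith⟩)
    have h1 := ih κ hκ a c hc.1 ha hcn fun s hs t ht =>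
      h s ⟨hs.1, hs.2.trans hc.2⟩ t ⟨ht.1, ht.2.trans hc.2⟩
    have h2 := h b ⟨hab, le_rfl⟩ c hc
    rw [abs_of_nonneg (sub_nonneg.mpr hc.2), hb, hcn] at h2
    have h3 : Real.cos (Real.pi * ((n + 1 : ℕ) : ℝ)) = -Real.cos (Real.pi * n) := by
      rw [← Real.cos_add_pi]
      congr 1
      push_cast
      ring
    have h4 : |Real.cos (Real.pi * n)| = 1 := by
      rw [mul_comm]
      exact Real.abs_cos_int_mul_pi n
    have h5 : |Real.cos (Real.pi * ((n + 1 : ℕ) : ℝ)) - Real.cos (Real.pi * n)| = 2 := by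
      rw [h3, show -Real.cos (Real.pi * n) - Real.cos (Real.pi * n) =
        -(2 * Real.cos (Real.pi * n)) by ring, abs_neg, abs_mul, h4]
      norm_num
    rw [h5] at h2
    push_cast
    linarith

theorem isClosed_fixSet {X : Type*} [TopologicalSpace X] [T2Space X] (T : Flow ℝ X) :
    IsClosed T.fixSet := by
  have : T.fixSet = ⋂ t : ℝ, {x | T t x = x} := by
    ext x
    simp [fixSet]
  rw [this]
  exact isClosed_iInter fun t => isClosed_eq (T.continuous continuous_const continuous_id)
    continuous_id

theorem exists_pos_le_apply_ne {X : Type*} [TopologicalSpace X] (T : Flow ℝ X) {p : X}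
    (hp : p ∉ T.fixSet) {a : ℝ} (ha : 0 < a) : ∃ b, 0 < b ∧ b ≤ a ∧ T b p ≠ p := by
  by_contra! h
  have hnat : ∀ b, T b p = p → ∀ n : ℕ, T (n * b) p = p := by
    intro b hb n
    induction n with
    | zero => simp
    | succ n ih => rw [Nat.cast_succ, add_mul, one_mul, T.map_add, hb, ih]
  have hpos : ∀ t, 0 < t → T t p = p := by
    intro t ht
    obtain ⟨n, hn⟩ := exists_nat_gt (t / a)
    have hn0 : (0 : ℝ) < n := (div_pos ht ha).trans hn
    have h1 := hnat (t / n) (h _ (div_pos ht hn0) (by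
      rw [div_le_iff₀ hn0]
      rw [div_lt_iff₀ ha] at hn
      linarith)) n
    rwa [mul_div_cancel₀ _ hn0.ne'] at h1
  refine hp fun t => ?_
  rcases lt_trichotomy t 0 with ht | rfl | ht
  · conv_lhs => rw [← hpos (-t) (by linarith)]
    rw [← T.map_add, add_neg_cancel, T.map_zero_apply]
  · exact T.map_zero_apply p
  · exact hpos t ht

/-! ### Separating two points by perturbation -/

section Perturbation

variable {X : Type*} [MetricSpace X] {T : Flow ℝ X}

/-- A function whose Lipschitz constant along orbits is less than one can be perturbed near a
non-fixed point `p` so as to separate the orbits through a neighbourhood of `p` from those through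
a neighbourhood of another point `q`: the perturbed function has slope one along pieces of the
former orbits, and is unchanged along the corresponding pieces of the latter. -/
theorem exists_perturbation {p q : X} (hp : p ∉ T.fixSet) (hpq : p ≠ q) :
    ∃ A ∈ 𝓝 p, ∃ B ∈ 𝓝 q, ∀ (ε : ℝ) (f : C(X, ℝ)), 0 < ε → (∀ x, ε ≤ f x) → (∀ x, f x ≤ 1) →
      (∀ t x, |f (T t x) - f x| ≤ (1 - ε) * |t|) →
      ∃ g : C(X, ℝ), (∀ x, 0 ≤ g x) ∧ (∀ x, g x ≤ 1) ∧ (∀ t x, |g (T t x) - g x| ≤ |t|) ∧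
        (∀ x ∈ T.fixSet, g x = f x) ∧ (∀ x, |g x - f x| ≤ ε) ∧
        ∀ x ∈ A, ∀ y ∈ B, ∃ t, g (T t x) ≠ g (T t y) := by
  have hcont : Continuous fun z : ℝ × X => T z.1 z.2 := T.continuous continuous_fst continuous_snd
  -- `q` may lie on the orbit of `p`, so only a short time window is safe.
  obtain ⟨a, ha, ha'⟩ : ∃ a > 0, ∀ s, |s| ≤ a → T s q ≠ p := by
    have h1 : ∀ᶠ s in 𝓝 (0 : ℝ), T s q ≠ p := by
      refine (T.continuous continuous_id continuous_const).continuousAt.eventually_ne ?_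
      simpa using hpq.symm
    obtain ⟨a, ha, h⟩ := Metric.nhds_basis_closedBall.eventually_iff.mp h1
    exact ⟨a, ha, fun s hs => h (by simpa [Real.dist_eq] using hs)⟩
  obtain ⟨b, hb, hba, hbp⟩ := T.exists_pos_le_apply_ne hp (half_pos ha)
  obtain ⟨r, hr, hrfix, hrb, hrq⟩ : ∃ r > 0, (∀ x ∈ T.fixSet, r ≤ dist x p) ∧
      r < dist (T b p) p ∧ ∀ᶠ y in 𝓝 q, ∀ s ∈ Icc (-a) a, r < dist (T s y) p := by
    obtain ⟨r₁, h₁, h₁'⟩ := Metric.mem_nhds_iff.mp (T.isClosed_fixSet.isOpen_compl.mem_nhds hp)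
    have h₂ := dist_pos.mpr hbp
    obtain ⟨s₀, hs₀, hmin⟩ := (isCompact_Icc (a := -a) (b := a)).exists_isMinOn
      ⟨0, by constructor <;> linarith⟩ (f := fun s => dist (T s q) p)
      ((T.continuous continuous_id continuous_const).dist continuous_const).continuousOn
    have h₃ : 0 < dist (T s₀ q) p := dist_pos.mpr (ha' s₀ (abs_le.mpr hs₀))
    refine ⟨min r₁ (min (dist (T b p) p) (dist (T s₀ q) p)) / 2, by positivity, ?_, ?_, ?_⟩
    · intro x hx
      by_contra! hlt
      have hm := min_le_left r₁ (min (dist (T b p) p) (dist (T s₀ q) p))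
      exact h₁' (show x ∈ Metric.ball p r₁ by rw [Metric.mem_ball]; linarith) hx
    · have := (min_le_right r₁ (min (dist (T b p) p) (dist (T s₀ q) p))).trans (min_le_left _ _)
      linarith
    · refine isCompact_Icc.eventually_forall_of_forall_eventually fun s hs => ?_
      have hm := (min_le_right r₁ (min (dist (T b p) p) (dist (T s₀ q) p))).trans (min_le_right _ _)
      have h₄ : dist (T s₀ q) p ≤ dist (T s q) p := hmin hs
      exact continuousAt_const.eventually_lt
        (g := fun z : X × ℝ => dist (T z.2 z.1) p)
        ((hcont.comp continuous_swap).dist continuous_const).continuousAt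
        (by simp only; linarith)
  -- The peak value 2 ensures that `k` falls through 1 to 0 along `[0, b]` for starting points near
  -- `p`.
  set k : X → ℝ := fun x => max 0 (2 * (1 - dist x p / r)) with hk
  have hkc : Continuous k := by fun_prop
  have hk0 : ∀ x, r ≤ dist x p → k x = 0 := by
    intro x hx
    have : 1 ≤ dist x p / r := (one_le_div hr).mpr hx
    exact max_eq_left (by linarith)
  refine ⟨{x | 1 < k x ∧ r < dist (T b x) p}, ?_,
    {y | ∀ s ∈ Icc (-a) a, r < dist (T s y) p}, hrq, ?_⟩
  · refine IsOpen.mem_nhds ((isOpen_lt continuous_const hkc).inter (isOpen_lt continuous_const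
      ((T.continuous continuous_const continuous_id).dist continuous_const))) ⟨?_, hrb⟩
    simp [hk]
  intro ε f hε hfε hf1 hflip
  -- `δ ≤ ε` keeps `F ≥ 0`; minimisers satisfy `ε * |t| ≤ δ`, so the second bound gives `|t| ≤ a /
  -- 4`.
  obtain ⟨δ, hδ, hδε, hδa⟩ : ∃ δ > 0, δ ≤ ε ∧ δ ≤ ε * (a / 4) :=
    ⟨min ε (ε * (a / 4)), by positivity, min_le_left _ _, min_le_right _ _⟩
  obtain ⟨N, hN⟩ := exists_nat_gt (2 * b / δ)
  have hN0 : (0 : ℝ) < N := lt_of_le_of_lt (by positivity) hN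
  set ψ : X → ℝ := fun x => (1 - Real.cos (Real.pi * (N * k x))) / 2 with hψ
  have hψc : Continuous ψ := by fun_prop
  have hψ0 : ∀ x, 0 ≤ ψ x := fun x => by
    have := Real.cos_le_one (Real.pi * (N * k x))
    simp only [hψ]
    linarith
  have hψ1 : ∀ x, ψ x ≤ 1 := fun x => by
    have := Real.neg_one_le_cos (Real.pi * (N * k x))
    simp only [hψ]
    linarith
  have hψk : ∀ x, r ≤ dist x p → ψ x = 0 := fun x hx => by simp [hψ, hk0 x hx]
  set F : X → ℝ := fun x => f x - δ * ψ x with hF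
  have hFf : ∀ x, F x ≤ f x := fun x => by
    have := mul_nonneg hδ.le (hψ0 x)
    simp only [hF]
    linarith
  have hfF : ∀ x, f x - δ ≤ F x := fun x => by
    have := mul_le_mul_of_nonneg_left (hψ1 x) hδ.le
    simp only [hF]
    linarith
  have hF0 : ∀ x, 0 ≤ F x := fun x => by linarith [hfF x, hfε x]
  obtain ⟨g, hle, hex⟩ := T.exists_infConvolution (F := F) (by fun_prop) hF0
    (fun x => (hFf x).trans (hf1 x)) one_pos
  have hglip := lipschitz_of_infConvolution zero_le_one hle hex
  have hgF : ∀ x, g x ≤ F x := fun x => by simpa using hle x 0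
  simp only [one_mul] at hle hex hglip
  have hmin : ∀ x t, g x = F (T t x) + |t| → f x - δ ≤ g x ∧ |t| ≤ a / 4 := by
    intro x t ht
    have h1 := abs_le.mp (hflip t x)
    have h2 := hfF (T t x)
    have h3 := (hgF x).trans (hFf x)
    have h4 : 0 ≤ ε * |t| := by positivity
    have h5 : ε * |t| ≤ ε * (a / 4) := by linarith
    exact ⟨by linarith, le_of_mul_le_mul_left h5 hε⟩
  refine ⟨g, fun x => ?_, fun x => ((hgF x).trans (hFf x)).trans (hf1 x), hglip, fun x hx => ?_,
    fun x => ?_, fun x hx y hy => ?_⟩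
  · obtain ⟨t, ht⟩ := hex x
    rw [ht]
    exact add_nonneg (hF0 _) (abs_nonneg _)
  · obtain ⟨t, ht⟩ := hex x
    have h1 := hgF x
    rw [hx t] at ht
    have h2 : F x = f x := by simp [hF, hψk x (hrfix x hx)]
    linarith [abs_nonneg t]
  · obtain ⟨t, ht⟩ := hex x
    have h1 := (hmin x t ht).1
    have h2 := (hgF x).trans (hFf x)
    rw [abs_le]
    constructor <;> linarith
  by_contra! hxy
  -- Minimising times stay in the window, where `y` avoids the bump; slope below 1 then makes time 0
  -- optimal.
  have hgfy : ∀ s, |s| ≤ 3 * a / 4 → g (T s y) = f (T s y) := by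
    intro s hs
    obtain ⟨t, ht⟩ := hex (T s y)
    have h1 := (hmin _ t ht).2
    have h2 : F (T t (T s y)) = f (T t (T s y)) := by
      have : r < dist (T t (T s y)) p := by
        rw [← T.map_add]
        refine hy _ (abs_le.mp ?_)
        linarith [abs_add_le t s]
      simp [hF, hψk _ this.le]
    have h3 := abs_le.mp (hflip t (T s y))
    have h4 : 0 ≤ ε * |t| := by positivity
    have h5 := (hgF (T s y)).trans (hFf _)
    linarith
  -- By `hxy`, `g` inherits the slope `1 - ε` of `f` along `y`, which forces the minimiser `t = 0`.
  have hgFx : ∀ s ∈ Icc 0 b, g (T s x) = F (T s x) := by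
    intro s hs
    obtain ⟨t, ht⟩ := hex (T s x)
    have h1 := (hmin _ t ht).2
    have h2 := hgF (T t (T s x))
    rw [← T.map_add, hxy] at h2
    have hsabs : |s| ≤ a / 2 := by
      rw [abs_of_nonneg hs.1]
      exact hs.2.trans hba
    have h3 := hgfy s (by linarith)
    have h4 := hgfy (t + s) (by linarith [abs_add_le t s])
    have h5 := abs_le.mp (hflip t (T s y))
    rw [← T.map_add] at h5 ht
    have h6 := hxy s
    have h7 : ε * |t| ≤ 0 := by linarith
    have h8 : t = 0 := by
      by_contra hne
      have := mul_pos hε (abs_pos.mpr hne)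
      linarith
    simpa [h8] using ht
  obtain ⟨hkx, hbx⟩ := hx
  have horb : Continuous fun s => T s x := T.continuous continuous_id continuous_const
  obtain ⟨c, hc, hck⟩ := intermediate_value_Icc' hb.le (hkc.comp horb).continuousOn
    (show (1 : ℝ) ∈ Icc (k (T b x)) (k (T 0 x)) by
      rw [hk0 _ hbx.le, T.map_zero_apply]
      exact ⟨zero_le_one, hkx.le⟩)
  -- Time is reversed so that the phase rises from 0 to `N`. The cosine is `2 / δ` times `F - f` up
  -- to a constant, hence `4 / δ`.
  have hosc := natCast_le_of_lipschitz_cos (L := 4 / δ) N (fun s => N * k (T (-s) x))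
    (continuous_const.mul (hkc.comp (horb.comp continuous_neg))) (-b) (-c) (by linarith [hc.2])
    (by simp [hk0 _ hbx.le]) (by simp [show k (T c x) = 1 from hck]) ?_
  · have h1 : 4 / δ * (-c - -b) ≤ 4 / δ * b :=
      mul_le_mul_of_nonneg_left (by linarith [hc.1]) (by positivity)
    have h2 : 4 / δ * b = 2 * (2 * b / δ) := by ring
    linarith
  · have hwlog : ∀ s ∈ Icc 0 b, ∀ t ∈ Icc 0 b,
        |Real.cos (Real.pi * (N * k (T s x))) - Real.cos (Real.pi * (N * k (T t x)))| ≤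
          4 / δ * |s - t| := by
      intro s hs t ht
      have h1 := hglip (s - t) (T t x)
      have h2 := hflip (s - t) (T t x)
      rw [← T.map_add, sub_add_cancel] at h1 h2
      rw [hgFx s hs, hgFx t ht] at h1
      have h3 : 0 ≤ ε * |s - t| := by positivity
      have h4 : Real.cos (Real.pi * (N * k (T s x))) - Real.cos (Real.pi * (N * k (T t x))) =
          2 / δ * ((F (T s x) - F (T t x)) - (f (T s x) - f (T t x))) := by
        simp only [hF, hψ]
        field_simp
        ring
      rw [h4, abs_mul, abs_of_pos (show 0 < 2 / δ by positivity)]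
      have h5 : |F (T s x) - F (T t x) - (f (T s x) - f (T t x))| ≤ 2 * |s - t| :=
        (abs_sub _ _).trans (by linarith)
      calc _ ≤ 2 / δ * (2 * |s - t|) := mul_le_mul_of_nonneg_left h5 (by positivity)
        _ = _ := by ring
    intro s hs t ht
    have hsc := hc.1
    have := hwlog (-s) ⟨by linarith [hs.2], by linarith [hs.1]⟩ (-t)
      ⟨by linarith [ht.2], by linarith [ht.1]⟩
    rwa [neg_sub_neg, abs_sub_comm t s] at this

end Perturbation

/-! ### Baire category in the space of extensions -/

/-- The continuous functions `X → [0,1]` with Lipschitz constant at most one along orbits which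
extend a given function on the fixed point set. -/
def lipExtensions {X : Type*} [TopologicalSpace X] (T : Flow ℝ X) (h : T.fixSet → ℝ) :
    Set C(X, ℝ) :=
  {f | (∀ x, f x ∈ Icc (0 : ℝ) 1) ∧ (∀ t x, |f (T t x) - f x| ≤ |t|) ∧
    ∀ x : T.fixSet, f x = h x}

theorem isClosed_lipExtensions {X : Type*} [TopologicalSpace X] (T : Flow ℝ X)
    (h : T.fixSet → ℝ) : IsClosed (T.lipExtensions h) := by
  have hev : ∀ x : X, Continuous fun f : C(X, ℝ) => f x := fun x =>
    continuous_eval_const x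
  simp only [lipExtensions, Set.ofPred_and, Set.ofPred_forall]
  refine (isClosed_iInter fun x => isClosed_Icc.preimage (hev x)).inter
    ((isClosed_iInter fun t => isClosed_iInter fun x => ?_).inter
      (isClosed_iInter fun x => isClosed_eq (hev x) continuous_const))
  exact isClosed_le ((hev _).sub (hev x)).abs continuous_const

theorem isOpen_separating {X : Type*} [TopologicalSpace X] [CompactSpace X] (T : Flow ℝ X)
    {K : Set (X × X)} (hK : IsCompact K) :
    IsOpen {f : C(X, ℝ) | ∀ z ∈ K, ∃ t, f (T t z.1) ≠ f (T t z.2)} := by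
  rw [isOpen_iff_eventually]
  intro f hf
  refine hK.eventually_forall_of_forall_eventually fun z hz => ?_
  obtain ⟨t, ht⟩ := hf z hz
  have hT : Continuous fun x => T t x := T.continuous continuous_const continuous_id
  have h1 : Continuous fun w : C(X, ℝ) × X × X => w.1 (T t w.2.1) := by fun_prop
  have h2 : Continuous fun w : C(X, ℝ) × X × X => w.1 (T t w.2.2) := by fun_prop
  filter_upwards [(isOpen_ne_fun h1 h2).mem_nhds (x := (f, z)) ht] with w hw
  exact ⟨t, hw⟩

section Separation

variable {X : Type*} [MetricSpace X] {T : Flow ℝ X}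

/-- An extension of `h` whose values and Lipschitz constant stay away from the extremes. -/
theorem exists_strict_lipExtension {h : T.fixSet → ℝ} (hc : Continuous h)
    (hh : ∀ x, h x ∈ Icc (1 / 4 : ℝ) (3 / 4)) :
    ∃ f : C(X, ℝ), (∀ x, f x ∈ Icc (1 / 4 : ℝ) 1) ∧ (∀ t x, |f (T t x) - f x| ≤ 1 / 2 * |t|) ∧
      ∀ x : T.fixSet, f x = h x := by
  obtain ⟨F, hF, hFh⟩ := ContinuousMap.exists_restrict_eq_forall_mem_of_closed
    (⟨h, hc⟩ : C(T.fixSet, ℝ)) hh ⟨1 / 2, by norm_num, by norm_num⟩ T.isClosed_fixSet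
  obtain ⟨g, hle, hex⟩ := T.exists_infConvolution F.continuous
    (fun x => by linarith [(hF x).1]) (fun x => by linarith [(hF x).2])
    (show (0 : ℝ) < 1 / 2 by norm_num)
  refine ⟨g, fun x => ⟨?_, ?_⟩, lipschitz_of_infConvolution (by norm_num) hle hex, fun x => ?_⟩
  · obtain ⟨t, ht⟩ := hex x
    linarith [(hF (T t x)).1, abs_nonneg t]
  · have := hle x 0
    rw [abs_zero] at this
    linarith [(hF (T 0 x)).2]
  · rw [infConvolution_eq_of_mem_fixSet (by norm_num) hle hex x.2]
    exact DFunLike.congr_fun hFh x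

variable [CompactSpace X]

theorem exists_dense_separating {h : T.fixSet → ℝ} (hc : Continuous h)
    (hh : ∀ x, h x ∈ Icc (1 / 4 : ℝ) (3 / 4)) {p q : X} (hp : p ∉ T.fixSet) (hpq : p ≠ q) :
    ∃ A ∈ 𝓝 p, ∃ B ∈ 𝓝 q,
      Dense {f : T.lipExtensions h | ∀ x ∈ A, ∀ y ∈ B, ∃ t, f.1 (T t x) ≠ f.1 (T t y)} := by
  obtain ⟨f₀, h0, h0lip, h0h⟩ := exists_strict_lipExtension hc hh
  obtain ⟨A, hA, B, hB, hAB⟩ := exists_perturbation hp hpq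
  refine ⟨A, hA, B, hB, Metric.dense_iff.mpr fun f η hη => ?_⟩
  obtain ⟨ε, hε, hε1, hεη⟩ : ∃ ε > 0, ε ≤ 1 ∧ 2 * ε < η :=
    ⟨min 1 (η / 4), by positivity, min_le_left _ _, by linarith [min_le_right 1 (η / 4)]⟩
  obtain ⟨hf01, hflip, hfh⟩ := f.2
  -- The blend has values at least `ε / 4` and slope at most `1 - ε / 2`.
  obtain ⟨g, hg0, hg1, hglip, hgfix, hgf, hsep⟩ := hAB (ε / 4) ((1 - ε) • f.1 + ε • f₀)
    (by positivity)
    (fun x => by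
      have h1 := mul_nonneg (sub_nonneg.mpr hε1) (hf01 x).1
      have h2 := mul_le_mul_of_nonneg_left (h0 x).1 hε.le
      simp only [ContinuousMap.add_apply, ContinuousMap.smul_apply, smul_eq_mul]
      linarith)
    (fun x => by
      have h1 := mul_le_mul_of_nonneg_left (hf01 x).2 (sub_nonneg.mpr hε1)
      have h2 := mul_le_mul_of_nonneg_left (h0 x).2 hε.le
      simp only [ContinuousMap.add_apply, ContinuousMap.smul_apply, smul_eq_mul]
      linarith)
    (fun t x => by
      have h1 := mul_le_mul_of_nonneg_left (hflip t x) (sub_nonneg.mpr hε1)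
      have h2 := mul_le_mul_of_nonneg_left (h0lip t x) hε.le
      have h3 : 0 ≤ ε * |t| := by positivity
      simp only [ContinuousMap.add_apply, ContinuousMap.smul_apply, smul_eq_mul]
      calc _ = |(1 - ε) * (f.1 (T t x) - f.1 x) + ε * (f₀ (T t x) - f₀ x)| := by ring_nf
        _ ≤ (1 - ε) * |f.1 (T t x) - f.1 x| + ε * |f₀ (T t x) - f₀ x| := by
          refine (abs_add_le _ _).trans_eq ?_
          rw [abs_mul, abs_mul, abs_of_nonneg (sub_nonneg.mpr hε1), abs_of_pos hε]
        _ ≤ _ := by linarith)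
  simp only [ContinuousMap.add_apply, ContinuousMap.smul_apply, smul_eq_mul] at hgfix hgf
  refine ⟨⟨g, fun x => ⟨hg0 x, hg1 x⟩, hglip, fun x => ?_⟩, ?_, hsep⟩
  · rw [hgfix x x.2, hfh, h0h]
    ring
  · rw [Metric.mem_ball, Subtype.dist_eq]
    refine lt_of_le_of_lt ((ContinuousMap.dist_le (by positivity)).mpr fun x => ?_) hεη
    rw [Real.dist_eq]
    have h1 := abs_le.mp (hgf x)
    have h2 : |f₀ x - f.1 x| ≤ 1 := by
      rw [abs_le]
      constructor <;> linarith [(h0 x).1, (h0 x).2, (hf01 x).1, (hf01 x).2]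
    have h3 := abs_le.mp h2
    have h4 := mul_le_mul_of_nonneg_left h3.1 hε.le
    have h5 := mul_le_mul_of_nonneg_left h3.2 hε.le
    rw [abs_le]
    constructor <;> linarith

/-- Countably many open dense conditions handle pairs with a non-fixed point; injectivity of `h`
handles two fixed points. -/
theorem exists_separating_lipExtension {h : T.fixSet → ℝ} (hc : Continuous h)
    (hinj : Function.Injective h) (hh : ∀ x, h x ∈ Icc (1 / 4 : ℝ) (3 / 4)) :
    ∃ f ∈ T.lipExtensions h, ∀ x y, (∀ t, f (T t x) = f (T t y)) → x = y := by
  let O : Set (X × X) := {z | z.1 ∉ T.fixSet ∧ z.1 ≠ z.2}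
  have hnhds : ∀ z : X × X, ∃ K ∈ 𝓝 z, IsCompact K ∧ (z ∈ O →
      Dense {f : T.lipExtensions h | ∀ w ∈ K, ∃ t, f.1 (T t w.1) ≠ f.1 (T t w.2)}) := by
    intro z
    by_cases hz : z ∈ O
    · obtain ⟨A, hA, B, hB, hd⟩ := exists_dense_separating hc hh hz.1 hz.2
      obtain ⟨K, hK, hKs, hKc⟩ := local_compact_nhds (prod_mem_nhds hA hB)
      refine ⟨K, hK, hKc, fun _ => hd.mono ?_⟩
      intro f hf w hw
      exact hf w.1 (hKs hw).1 w.2 (hKs hw).2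
    · exact ⟨univ, univ_mem, isCompact_univ, fun h => absurd h hz⟩
  choose K hKn hKc hKd using hnhds
  obtain ⟨S, hSO, hS, hcov⟩ := TopologicalSpace.countable_cover_nhdsWithin (s := O) (f := K)
    fun z _ => mem_nhdsWithin_of_mem_nhds (hKn z)
  have : CompleteSpace (T.lipExtensions h) := (T.isClosed_lipExtensions h).completeSpace_coe
  have : Nonempty (T.lipExtensions h) := by
    obtain ⟨f₀, h0, h0lip, h0h⟩ := exists_strict_lipExtension hc hh
    exact ⟨⟨f₀, fun x => ⟨by linarith [(h0 x).1], (h0 x).2⟩,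
      fun t x => (h0lip t x).trans (by linarith [abs_nonneg t]), h0h⟩⟩
  obtain ⟨f, hf⟩ := (dense_biInter_of_isOpen (S := S)
    (f := fun z : X × X => {f : T.lipExtensions h | ∀ w ∈ K z, ∃ t, f.1 (T t w.1) ≠ f.1 (T t w.2)})
    (fun z _ => (T.isOpen_separating (hKc z)).preimage continuous_subtype_val) hS
    fun z hz => hKd z (hSO hz)).nonempty
  have hsep : ∀ x y, x ∉ T.fixSet → (∀ t, f.1 (T t x) = f.1 (T t y)) → x = y := by
    intro x y hx hxy
    by_contra hne
    obtain ⟨z, hz, hxz⟩ := mem_iUnion₂.mp (hcov (show (x, y) ∈ O from ⟨hx, hne⟩))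
    obtain ⟨t, ht⟩ := mem_iInter₂.mp hf z hz (x, y) hxz
    exact ht (hxy t)
  refine ⟨f.1, f.2, fun x y hxy => ?_⟩
  by_cases hx : x ∈ T.fixSet
  · by_cases hy : y ∈ T.fixSet
    · have h1 := hxy 0
      rw [T.map_zero_apply, T.map_zero_apply] at h1
      have h2 := f.2.2.2 ⟨x, hx⟩
      have h3 := f.2.2.2 ⟨y, hy⟩
      exact congrArg Subtype.val (hinj (h2.symm.trans (h1.trans h3)))
    · exact (hsep y x hy fun t => (hxy t).symm).symm
  · exact hsep x y hx hxy

/-! ### From functions to embeddings and back -/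

theorem exists_isEquivariantEmbedding_of_separating {f : C(X, ℝ)}
    (hf : ∀ x, f x ∈ unitInterval) (hlip : ∀ t x, |f (T t x) - f x| ≤ |t|)
    (hsep : ∀ x y, (∀ t, f (T t x) = f (T t y)) → x = y) :
    ∃ Φ : X → LipSpace, T.IsEquivariantEmbedding LipSpace.flow Φ := by
  have hT : Continuous fun z : X × ℝ => T z.2 z.1 := T.continuous continuous_snd continuous_fst
  have hj : Continuous fun z : X × ℝ => (⟨f (T z.2 z.1), hf _⟩ : unitInterval) :=
    (f.continuous.comp hT).subtype_mk _
  refine ⟨fun x => ⟨⟨fun t => ⟨f (T t x), hf _⟩, hj.comp (Continuous.prodMk_right x)⟩,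
    fun s t => ?_⟩, ?_, fun t x => ?_⟩
  · have := hlip (s - t) (T t x)
    rwa [← T.map_add, sub_add_cancel] at this
  · refine (Continuous.isClosedEmbedding ?_ fun x y hxy => hsep x y fun t => ?_).isEmbedding
    · exact (ContinuousMap.continuous_of_continuous_uncurry _ hj).subtype_mk _
    · exact congrArg (fun φ : LipSpace => ((φ.1 t : unitInterval) : ℝ)) hxy
  · refine Subtype.ext (ContinuousMap.ext fun s => Subtype.ext ?_)
    change f (T s (T t x)) = f (T (s + t) x)
    rw [T.map_add]

theorem IsEquivariantEmbedding.exists_isEmbedding_fixSet {f : X → LipSpace}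
    (hf : T.IsEquivariantEmbedding LipSpace.flow f) :
    ∃ g : T.fixSet → unitInterval, IsEmbedding g := by
  have : CompactSpace T.fixSet := isCompact_iff_compactSpace.mp T.isClosed_fixSet.isCompact
  have hconst : ∀ (x : T.fixSet) (t : ℝ), (f x).1 t = (f x).1 0 := by
    intro x t
    have h1 := congrArg (fun φ : LipSpace => φ.1 0) (hf.equivariant t x)
    rw [x.2 t] at h1
    refine Eq.trans ?_ h1.symm
    change (f x).1 t = (f x).1 (0 + t)
    rw [zero_add]
  refine ⟨fun x => (f x).1 0, (Continuous.isClosedEmbedding ?_ fun x y hxy => ?_).isEmbedding⟩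
  · exact (continuous_eval_const (0 : ℝ)).comp
      (continuous_subtype_val.comp (hf.isEmbedding.continuous.comp continuous_subtype_val))
  · refine Subtype.ext (hf.isEmbedding.injective (Subtype.ext (ContinuousMap.ext fun t => ?_)))
    rw [hconst x, hconst y]
    exact hxy

end Separation

end Flow

theorem theorem1p2 {X : Type*} [MetricSpace X] [CompactSpace X] (T : Flow ℝ X) :
    (∃ f : X → LipSpace, T.IsEquivariantEmbedding LipSpace.flow f) ↔
      ∃ g : T.fixSet → unitInterval, IsEmbedding g := by
  refine ⟨fun ⟨f, hf⟩ => hf.exists_isEmbedding_fixSet, fun ⟨g, hg⟩ => ?_⟩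
  obtain ⟨f, hf, hsep⟩ := Flow.exists_separating_lipExtension (T := T)
    -- The lower bound `1 / 4` leaves room for perturbations, which only lower values.
    (h := fun x => 1 / 4 + 1 / 2 * (g x : ℝ))
    (continuous_const.add (continuous_const.mul (continuous_subtype_val.comp hg.continuous)))
    (fun x y hxy => hg.injective (Subtype.ext (by simpa using hxy)))
    (fun x => ⟨by linarith [(g x).2.1], by linarith [(g x).2.2]⟩)
  exact Flow.exists_isEquivariantEmbedding_of_separating hf.1 hf.2.1 hsep
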